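/- Let $k$ be a commutative artinian ring, $E$ the minimal injective cogenerator of $k$ (the injective envelope of $\bigoplus_{\mathfrak m} k/\mathfrak m$, the sum over the maximal ideals of $k$), and $D=\mathrm{Hom}_k(-,E)$. Let $\mathcal A$ be a $k$-linear abelian category all of whose Hom-modules are finitely generated over $k$. A morphism $\alpha$ of $\mathcal A$ is projectively trivial if $\mathrm{Ext}^1_{\mathcal A}(\alpha,-)=0$ and injectively trivial if $\mathrm{Ext}^1_{\mathcal A}(-,\alpha)=0$. Let $\mathcal P$ and $\mathcal I$ be the ideals of these morphisms, let $\underline{\mathcal A}=\mathcal A/\mathcal P$ and $\overline{\mathcal A}=\mathcal A/\mathcal I$ be the factor categories, and write $\underline{\mathrm{Hom}}_{\mathcal A}=\mathrm{Hom}_{\mathcal A}/\mathcal P$ and $\overline{\mathrm{Hom}}_{\mathcal A}=\mathrm{Hom}_{\mathcal A}/\mathcal I$ for their Hom-modules. Assume that $\mathcal A$ has Auslander-Reiten duality: there are a $k$-linear equivalence $\tau\colon\underline{\mathcal A}\to\overline{\mathcal A}$ and $k$-linear isomorphisms $\Phi_{X,Z}\colon D\,\mathrm{Ext}^1_{\mathcal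 A}(X,Z)\to\overline{\mathrm{Hom}}_{\mathcal A}(Z,\tau X)$, natural in $X$ and $Z$. Let $\tau^{-1}$ be a quasi-inverse of $\tau$, and let $$\Psi_{X,Z}\colon D\,\mathrm{Ext}^1_{\mathcal A}(X,Z)\to\underline{\mathrm{Hom}}_{\mathcal A}(\tau^{-1}Z,X)$$ be the isomorphism obtained by applying $\Phi_{X,Z}$, then $\tau^{-1}$, then a natural isomorphism $\tau^{-1}\tau\cong\mathrm{Id}_{\underline{\mathcal A}}$ at $X$. Let $K$ and $Y$ be objects of $\mathcal A$, put $C=\tau^{-1}K$, and let $\Gamma(C)=\mathrm{End}_{\mathcal A}(C)$. Then $\underline{\mathrm{Hom}}_{\mathcal A}(C,Y)$ is a left module over the opposite ring $\Gamma(C)^{\mathrm{op}}$ by composition, $g\cdot f=f\circ g$. Two morphisms to $Y$ are right equivalent if each factors through the other. A morphism $\alpha\colon X\to Y$ is right $C$-determined if every $t\colon T\to Y$, such that $t\circ\phi$ factors through $\alpha$ for all $\phi\colon C\to T$, factors through $\alpha$. Let ${}^C[\to Y\rangle_{\mathrm{epi}}$ be the set of right equivalence classes $[\alpha\rangle$ of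 right $C$-determined epimorphisms $\alpha$ to $Y$. Let $F$ be the composite $$D\,\underline{\mathrm{Hom}}_{\mathcal A}(C,Y)\xrightarrow{\;D\Psi_{Y,K}\;}\mathrm{Ext}^1_{\mathcal A}(Y,K)\xrightarrow{\;\kappa\;}{}^C[\to Y\rangle_{\mathrm{epi}}\xrightarrow{\;\eta_{C,Y}\;}\{\Gamma(C)^{\mathrm{op}}\text{-submodules of }\underline{\mathrm{Hom}}_{\mathcal A}(C,Y)\},$$ where $DD\,\mathrm{Ext}^1_{\mathcal A}(Y,K)$ is identified with $\mathrm{Ext}^1_{\mathcal A}(Y,K)$ by evaluation, $\kappa$ sends the class of an exact sequence $0\to K\to X\xrightarrow{\alpha}Y\to 0$ to $[\alpha\rangle$, and $\eta_{C,Y}([\alpha\rangle)$ is the image of $\underline{\mathrm{Hom}}_{\mathcal A}(C,\alpha)\colon\underline{\mathrm{Hom}}_{\mathcal A}(C,X)\to\underline{\mathrm{Hom}}_{\mathcal A}(C,Y)$. Then for every $k$-linear map $\theta\colon\underline{\mathrm{Hom}}_{\mathcal A}(C,Y)\to E$, $$F(\theta)=\{\,f\in\underline{\mathrm{Hom}}_{\mathcal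 A}(C,Y)\;:\;\theta(f\circ g)=0\text{ for all }g\in\Gamma(C)\,\},$$ and $F(\theta)$ is the largest $\Gamma(C)^{\mathrm{op}}$-submodule of $\underline{\mathrm{Hom}}_{\mathcal A}(C,Y)$ contained in $\operatorname{Ker}\theta$. -/

import Mathlib

open CategoryTheory Abelian Limits

universe w v u t

namespace AuslanderBij

section Realize
variable {A : Type u} [Category.{v} A] [Abelian A]

lemma epi_f_zero_of_quasiIso {X : CochainComplex A ℤ} {Y : A} [X.IsStrictlyLE 0]
    (s : X ⟶ (HomologicalComplex.single A (ComplexShape.up ℤ) 0).obj Y) [QuasiIso s] :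
    Epi (s.f 0) := by
  have i1 := HomologicalComplex.isIso_homologyπ
    ((HomologicalComplex.single A (ComplexShape.up ℤ) 0).obj Y) _ 0 rfl (by simp)
  have i2 := HomologicalComplex.isIso_iCycles
    ((HomologicalComplex.single A (ComplexShape.up ℤ) 0).obj Y) 0 _ rfl (by simp)
  have h1 : Epi (HomologicalComplex.cyclesMap s 0) := by
    have h := HomologicalComplex.homologyπ_naturality s 0
    have : HomologicalComplex.cyclesMap s 0 = X.homologyπ 0 ≫ HomologicalComplex.homologyMap s 0 ≫
        inv (HomologicalComplex.homologyπ _ 0) := by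
      rw [reassoc_of% h]; simp
    rw [this]; infer_instance
  have h2 : Epi (X.iCycles 0 ≫ s.f 0) := by
    rw [← HomologicalComplex.cyclesMap_i]; exact epi_comp _ _
  exact epi_of_epi (X.iCycles 0) _

variable [HasExt.{w} A]

lemma exists_epi_comp_eq_zero {Y K : A} (x : Ext.{w} Y K 1) :
    ∃ (X : A) (p : X ⟶ Y), Epi p ∧ (Ext.mk₀ p).comp x (zero_add 1) = 0 := by
  let := HasDerivedCategory.standard A
  let e := ((SingleFunctors.shiftIso (DerivedCategory.singleFunctors A) (1 : ℤ) (-1) 0 (by simp)).app K)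
  let f : DerivedCategory.Q.obj ((HomologicalComplex.single A (ComplexShape.up ℤ) 0).obj Y) ⟶
     DerivedCategory.Q.obj ((HomologicalComplex.single A (ComplexShape.up ℤ) (-1)).obj K) :=
    x.hom ≫ e.hom
  obtain ⟨X, hX, s, hs, g, fac⟩ := DerivedCategory.right_fac_of_isStrictlyLE f 0
  have hs' : QuasiIso s := (DerivedCategory.isIso_Q_map_iff_quasiIso _ s).1 hs
  have hepi := epi_f_zero_of_quasiIso s
  let j : (HomologicalComplex.single A (ComplexShape.up ℤ) 0).obj (X.X 0) ⟶ X :=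
    HomologicalComplex.mkHomFromSingle (𝟙 _) (fun k hk =>
      (X.isZero_of_isStrictlyLE 0 k (by simp at hk; lia)).eq_of_tgt _ _)
  let p : X.X 0 ⟶ Y := s.f 0 ≫ (HomologicalComplex.singleObjXSelf (ComplexShape.up ℤ) 0 Y).hom
  have hp : (HomologicalComplex.single A (ComplexShape.up ℤ) 0).map p = j ≫ s := by
    apply HomologicalComplex.from_single_hom_ext
    simp [j, p, HomologicalComplex.single_map_f_self]
  have hj : j ≫ g = 0 := by
    apply HomologicalComplex.from_single_hom_ext
    exact (HomologicalComplex.isZero_single_obj_X _ _ _ _ (by simp)).eq_of_tgt _ _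
  refine ⟨X.X 0, p, epi_comp _ _, ?_⟩
  have key : DerivedCategory.Q.map ((HomologicalComplex.single A (ComplexShape.up ℤ) 0).map p) ≫ f
      = 0 := by
    rw [hp, fac, Functor.map_comp, Category.assoc, IsIso.hom_inv_id_assoc, ← Functor.map_comp, hj,
      Functor.map_zero]
  ext
  rw [Ext.comp_hom, Ext.mk₀_hom, ShiftedHom.mk₀_comp, Ext.zero_hom, ← cancel_mono e.hom,
    Category.assoc, zero_comp]
  exact key

/-- Every element of `Ext¹(Y, K)` is the class `[ξ]` of an exact sequence `0 → K → X → Y → 0`. -/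
theorem exists_shortExact_extClass {Y K : A} (x : Ext.{w} Y K 1) :
    ∃ (X : A) (i : K ⟶ X) (α : X ⟶ Y) (h : i ≫ α = 0)
      (hS : (ShortComplex.mk i α h).ShortExact), hS.extClass = x := by
  obtain ⟨X, p, hp, hx⟩ := exists_epi_comp_eq_zero x
  let S : ShortComplex A := ShortComplex.mk (kernel.ι p) p (kernel.condition p)
  have hS : S.ShortExact := { exact := ShortComplex.exact_kernel p }
  obtain ⟨u', hu⟩ := Ext.contravariant_sequence_exact₃ hS K x hx (add_zero 1)
  obtain ⟨u, rfl⟩ := Ext.mk₀_bijective _ _ |>.2 u'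
  have sq := IsPushout.of_hasPushout (kernel.ι p) u
  let α : pushout (kernel.ι p) u ⟶ Y := pushout.desc p 0 (by simp)
  have hα : pushout.inr (kernel.ι p) u ≫ α = 0 := pushout.inr_desc _ _ _
  have hpα : pushout.inl (kernel.ι p) u ≫ α = p := pushout.inl_desc _ _ _
  have : Epi α := by
    have : Epi (pushout.inl (kernel.ι p) u ≫ α) := by rw [hpα]; exact hp
    exact epi_of_epi (pushout.inl (kernel.ι p) u) α
  have hT : (ShortComplex.mk _ α hα).ShortExact :=
    { exact := by
        apply ShortComplex.exact_of_g_is_cokernel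
        refine CokernelCofork.IsColimit.ofπ' _ _ (fun {Z} k hk => ?_)
        have hk' : kernel.ι p ≫ pushout.inl (kernel.ι p) u ≫ k = 0 := by
          rw [pushout.condition_assoc]; simp only at hk; rw [hk, comp_zero]
        refine ⟨hS.exact.desc (pushout.inl (kernel.ι p) u ≫ k) hk', ?_⟩
        apply pushout.hom_ext
        · rw [reassoc_of% hpα]; exact hS.exact.g_desc _ _
        · rw [reassoc_of% hα, zero_comp]; exact hk.symm }
  refine ⟨_, _, α, hα, hT, ?_⟩
  let φ : S ⟶ ShortComplex.mk _ α hα :=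
    { τ₁ := u, τ₂ := pushout.inl _ _, τ₃ := 𝟙 _
      comm₁₂ := pushout.condition.symm
      comm₂₃ := by simp [S, hpα] }
  have := ShortComplex.ShortExact.extClass_naturality hS hT φ
  rw [← hu]
  simpa [φ] using this.symm
end Realize
section Matlis
variable (k : Type t) [CommRing k] (E : Type t) [AddCommGroup E] [Module k E]

/-- `E` is the minimal injective cogenerator of `k`: an injective envelope of the direct sum of the
simple `k`-modules `k ⧸ m`, one for each maximal ideal `m`. -/
structure IsMinimalInjectiveCogenerator : Prop where
  injective : Module.Injective k E
  exists_essential : ∃ ι : (DirectSum (MaximalSpectrum k) fun m => k ⧸ m.asIdeal) →ₗ[k] E,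
    Function.Injective ι ∧ ∀ N : Submodule k E, N ≠ ⊥ → N ⊓ LinearMap.range ι ≠ ⊥

/-- The dual `D M = Hom_k(M, E)`. -/
abbrev MatlisDual (M : Type*) [AddCommGroup M] [Module k M] := M →ₗ[k] E

/-- The evaluation map `M → D D M`. -/
def evalMap (M : Type w) [AddCommGroup M] [Module k M] :
    M →ₗ[k] MatlisDual k E (MatlisDual k E M) := LinearMap.flip LinearMap.id

variable {k E}
namespace IsMinimalInjectiveCogenerator

lemma extend (hE : IsMinimalInjectiveCogenerator k E) {M N : Type w} [AddCommGroup M] [Module k M] [AddCommGroup N] [Module k N]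
    (i : M →ₗ[k] N) (hi : Function.Injective i) (φ : M →ₗ[k] E) : ∃ ψ : N →ₗ[k] E, ψ ∘ₗ i = φ := by
  exact (Module.Baer.of_injective hE.injective).extension_property i hi φ

open scoped Classical in
lemma exists_ne_zero (hE : IsMinimalInjectiveCogenerator k E) {M : Type w} [AddCommGroup M] [Module k M] {x : M} (hx : x ≠ 0) :
    ∃ φ : M →ₗ[k] E, φ x ≠ 0 := by
  obtain ⟨ι, hι, -⟩ := hE.exists_essential
  have hI : Ideal.torsionOf k M x ≠ ⊤ := by
    rw [Ne, Ideal.eq_top_iff_one, Ideal.mem_torsionOf_iff, one_smul]; exact hx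
  obtain ⟨m, hm, hle⟩ := Ideal.exists_le_maximal _ hI
  let f : (k ⧸ Ideal.torsionOf k M x) →ₗ[k] E :=
    ι ∘ₗ DirectSum.lof k (MaximalSpectrum k) (fun m => k ⧸ m.asIdeal) ⟨m, hm⟩ ∘ₗ
      Submodule.factor hle
  let g : Submodule.span k {x} →ₗ[k] E :=
    f ∘ₗ (Ideal.quotTorsionOfEquivSpanSingleton k M x).symm.toLinearMap
  obtain ⟨ψ, hψ⟩ := hE.extend (Submodule.span k {x}).subtype Subtype.val_injective g
  refine ⟨ψ, fun h0 => ?_⟩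
  have h1 : g ⟨x, Submodule.mem_span_singleton_self x⟩ = 0 := by
    rw [← hψ]; exact h0
  have h2 : (Ideal.quotTorsionOfEquivSpanSingleton k M x).symm
      ⟨x, Submodule.mem_span_singleton_self x⟩ = Submodule.Quotient.mk 1 := by
    rw [LinearEquiv.symm_apply_eq]
    ext
    exact (one_smul k x).symm
  simp only [g, f, LinearMap.comp_apply, LinearEquiv.coe_coe, h2] at h1
  rw [map_eq_zero_iff _ hι] at h1
  have h3 := (DirectSum.of_injective (β := fun m : MaximalSpectrum k => k ⧸ m.asIdeal) ⟨m, hm⟩).eq_iff.1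
    (h1.trans (map_zero _).symm)
  have h4 : (1 : k) ∈ m := (Submodule.Quotient.mk_eq_zero m).1 h3
  exact hm.ne_top ((Ideal.eq_top_iff_one m).2 h4)

lemma evalMap_injective (hE : IsMinimalInjectiveCogenerator k E) (M : Type w) [AddCommGroup M] [Module k M] :
    Function.Injective (evalMap k E M) := by
  rw [injective_iff_map_eq_zero]
  intro x hx
  by_contra h
  obtain ⟨φ, hφ⟩ := hE.exists_ne_zero h
  exact hφ (DFunLike.congr_fun hx φ)

open scoped Classical in
lemma exists_gen (hE : IsMinimalInjectiveCogenerator k E) (m : Ideal k) (hm : m.IsMaximal) :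
    ∃ e : E, (∀ a ∈ m, a • e = 0) ∧ ∀ y : E, (∀ a ∈ m, a • y = 0) → ∃ r : k, y = r • e := by
  obtain ⟨ι, hι, hess⟩ := hE.exists_essential
  refine ⟨ι (DirectSum.lof k (MaximalSpectrum k) (fun m => k ⧸ m.asIdeal) ⟨m, hm⟩
    (Submodule.Quotient.mk 1)), fun a ha => ?_, fun y hy => ?_⟩
  · rw [← map_smul, ← map_smul, ← Submodule.Quotient.mk_smul, smul_eq_mul, mul_one,
      (Submodule.Quotient.mk_eq_zero m).2 ha, map_zero, map_zero]
  by_cases hy0 : y = 0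
  · exact ⟨0, by simp [hy0]⟩
  have := hess (Submodule.span k {y}) (by simpa using hy0)
  obtain ⟨z, ⟨hz1, d, hd⟩, hz0⟩ := (Submodule.ne_bot_iff _).1 this
  obtain ⟨r, rfl⟩ := Submodule.mem_span_singleton.1 hz1
  have hr : r ∉ m := fun h => hz0 (hy r h)
  obtain ⟨s, a, ha, hsa⟩ := hm.exists_inv hr
  have hy1 : y = ι (s • d) := by
    rw [map_smul, hd, smul_smul]
    conv_lhs => rw [← one_smul k y, ← hsa, add_smul, hy a ha, add_zero]
  have hd0 : ∀ a ∈ m, a • (s • d) = 0 := fun a ha => hι (by rw [map_smul, ← hy1, hy a ha, map_zero])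
  obtain ⟨c, hc⟩ := Submodule.Quotient.mk_surjective _ ((s • d) ⟨m, hm⟩)
  refine ⟨c, ?_⟩
  rw [hy1, ← map_smul, ← map_smul]
  congr 1
  ext m'
  by_cases h : m' = ⟨m, hm⟩
  · subst h
    rw [DirectSum.lof_apply, ← hc, ← Submodule.Quotient.mk_smul, smul_eq_mul, mul_one]
  · rw [DirectSum.lof_eq_of, DirectSum.of_eq_of_ne _ _ _ h]
    have hne : ¬ m ≤ m'.asIdeal := fun hle => h (MaximalSpectrum.ext (hm.eq_of_le m'.isMaximal.ne_top hle).symm)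
    obtain ⟨a, ha, ha'⟩ := Set.not_subset.1 hne
    obtain ⟨b, c', hc', hb⟩ := m'.isMaximal.exists_inv ha'
    obtain ⟨q, hq⟩ := Submodule.Quotient.mk_surjective _ ((s • d) m')
    have h5 : a • (s • d) m' = 0 := by
      have := congrArg (fun z => z m') (hd0 a ha)
      exact this
    rw [← hq] at h5 ⊢
    rw [← Submodule.Quotient.mk_smul, Submodule.Quotient.mk_eq_zero] at h5
    rw [Submodule.Quotient.mk_eq_zero]
    have : q = b * (a • q) + c' * q := by
      rw [smul_eq_mul, ← mul_assoc, ← add_mul, hb, one_mul]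
    rw [this]
    exact m'.asIdeal.add_mem (m'.asIdeal.mul_mem_left _ h5) (m'.asIdeal.mul_mem_right _ hc')

lemma length_dual_simple (hE : IsMinimalInjectiveCogenerator k E) (M : Type w) [AddCommGroup M] [Module k M] [IsSimpleModule k M] :
    Module.length k (MatlisDual k E M) ≤ 1 := by
  obtain ⟨m, hm, ⟨φ⟩⟩ := isSimpleModule_iff_quot_maximal.1 (inferInstance : IsSimpleModule k M)
  obtain ⟨e, hme, he⟩ := hE.exists_gen m hm
  have hs : IsSimpleModule k (k ⧸ m) := isSimpleModule_iff_quot_maximal.2 ⟨m, hm, ⟨.refl _ _⟩⟩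
  let q : (k ⧸ m) →ₗ[k] E := Submodule.liftQ m (LinearMap.toSpanSingleton k _ e) hme
  let j : MatlisDual k E M →ₗ[k] E := LinearMap.applyₗ (φ.symm (Submodule.Quotient.mk 1))
  have hj : Function.Injective j := by
    rw [injective_iff_map_eq_zero]
    intro f hf
    ext x
    obtain ⟨r, hr⟩ := Submodule.Quotient.mk_surjective _ (φ x)
    have : x = r • φ.symm (Submodule.Quotient.mk 1) := by
      rw [← map_smul, ← Submodule.Quotient.mk_smul, smul_eq_mul, mul_one, hr,
        LinearEquiv.symm_apply_apply]
    rw [this, map_smul]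
    change r • j f = 0
    rw [hf, smul_zero]
  have hjm : ∀ f, j f ∈ LinearMap.range q := fun f => by
    obtain ⟨r, hr⟩ := he (j f) (fun a ha => by
      change a • f _ = 0
      rw [← map_smul, ← map_smul, ← Submodule.Quotient.mk_smul, smul_eq_mul, mul_one,
        (Submodule.Quotient.mk_eq_zero m).2 ha, map_zero, map_zero])
    exact ⟨Submodule.Quotient.mk r, hr.symm⟩
  calc Module.length k (MatlisDual k E M)
      ≤ Module.length k (LinearMap.range q) :=
        Module.length_le_of_injective (j.codRestrict _ hjm) (fun a b h =>
          hj (congrArg Subtype.val h))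
    _ ≤ Module.length k (k ⧸ m) :=
        Module.length_le_of_surjective q.rangeRestrict q.surjective_rangeRestrict
    _ ≤ 1 := (Module.length_eq_one k (k ⧸ m)).le

lemma length_dual_le (hE : IsMinimalInjectiveCogenerator k E) (M : Type w) [AddCommGroup M] [Module k M] (h : IsFiniteLength k M) :
    Module.length k (MatlisDual k E M) ≤ Module.length k M := by
  induction h with
  | of_subsingleton =>
    rw [Module.length_eq_zero]; simp
  | @of_simple_quotient M _ _ N _ _ ih =>
    let f : MatlisDual k E (M ⧸ N) →ₗ[k] MatlisDual k E M := LinearMap.lcomp k E N.mkQ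
    let g : MatlisDual k E M →ₗ[k] MatlisDual k E N := LinearMap.lcomp k E N.subtype
    have hf : Function.Injective f := fun a b h => by
      ext x
      exact DFunLike.congr_fun h x
    have hfg : Function.Exact f g.rangeRestrict := by
      intro φ
      constructor
      · intro hφ
        have h0 : g φ = 0 := congrArg Subtype.val hφ
        refine ⟨N.liftQ φ (fun x hx =>
          LinearMap.mem_ker.2 (DFunLike.congr_fun h0 ⟨x, hx⟩)), ?_⟩
        ext x; rfl
      · rintro ⟨ψ, rfl⟩
        apply Subtype.ext
        ext x
        change ψ (N.mkQ x) = 0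
        rw [Submodule.mkQ_apply, (Submodule.Quotient.mk_eq_zero N).2 x.2, map_zero]
    rw [Module.length_eq_add_of_exact f g.rangeRestrict hf g.surjective_rangeRestrict hfg,
      Module.length_eq_add_of_exact N.subtype N.mkQ Subtype.val_injective
        (Submodule.mkQ_surjective N) (LinearMap.exact_subtype_mkQ N), add_comm,
      Module.length_eq_one k (M ⧸ N)]
    exact add_le_add ((Module.length_le_of_injective (LinearMap.range g).subtype
      Subtype.val_injective).trans ih) (hE.length_dual_simple (M ⧸ N))

variable [IsArtinianRing k]

lemma finite_dual (hE : IsMinimalInjectiveCogenerator k E) (M : Type w) [AddCommGroup M] [Module k M] [Module.Finite k M] :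
    Module.Finite k (MatlisDual k E M) := by
  have h := hE.length_dual_le M
    (isFiniteLength_iff_isNoetherian_isArtinian.2 ⟨inferInstance, inferInstance⟩)
  have h2 : IsFiniteLength k (MatlisDual k E M) :=
    Module.length_ne_top_iff.1 (ne_top_of_le_ne_top Module.length_ne_top h)
  have := (isFiniteLength_iff_isNoetherian_isArtinian.1 h2).1
  infer_instance

lemma finite_of_dual (hE : IsMinimalInjectiveCogenerator k E) (M : Type w) [AddCommGroup M] [Module k M]
    [Module.Finite k (MatlisDual k E M)] : Module.Finite k M := by
  have := hE.finite_dual (MatlisDual k E M)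
  exact Module.Finite.of_injective (evalMap k E M) (hE.evalMap_injective M)

/-- `M → D D M` is an isomorphism for finitely generated `M`, so `D` is a duality on these modules. -/
theorem evalMap_bijective (hE : IsMinimalInjectiveCogenerator k E) (M : Type w) [AddCommGroup M] [Module k M] [Module.Finite k M] :
    Function.Bijective (evalMap k E M) := by
  refine ⟨hE.evalMap_injective M, ?_⟩
  have := hE.finite_dual M
  have := hE.finite_dual (MatlisDual k E M)
  have h1 := hE.length_dual_le M
    (isFiniteLength_iff_isNoetherian_isArtinian.2 ⟨inferInstance, inferInstance⟩)
  have h2 := (hE.length_dual_le (MatlisDual k E M)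
    (isFiniteLength_iff_isNoetherian_isArtinian.2 ⟨inferInstance, inferInstance⟩)).trans h1
  rw [← LinearMap.range_eq_top]
  by_contra hne
  have h3 := Submodule.length_lt hne
  have h4 := Module.length_le_of_injective (evalMap k E M).rangeRestrict (fun a b h =>
    hE.evalMap_injective M (congrArg Subtype.val h))
  exact absurd (h4.trans_lt (h3.trans_le h2)) (lt_irrefl _)

end IsMinimalInjectiveCogenerator
end Matlis

section Stable

/-- An ideal of a `k`-linear category, with `k`-submodules `hom X Y ⊆ Hom(X, Y)`. -/
structure HomIdeal (k : Type t) [CommRing k] (A : Type u) [Category.{v} A] [Preadditive A]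
    [Linear k A] where
  hom (X Y : A) : Submodule k (X ⟶ Y)
  comp_mem {X Y Z : A} (f : X ⟶ Y) {g : Y ⟶ Z} (hg : g ∈ hom Y Z) : f ≫ g ∈ hom X Z
  mem_comp {X Y Z : A} {f : X ⟶ Y} (hf : f ∈ hom X Y) (g : Y ⟶ Z) : f ≫ g ∈ hom X Z

/-- The factor category of a `k`-linear category by an ideal: the same objects, and the morphisms
`Hom(X, Y) ⧸ I(X, Y)`. -/
@[ext]
structure FactorCat {k : Type t} [CommRing k] {A : Type u} [Category.{v} A] [Preadditive A]
    [Linear k A] (I : HomIdeal k A) where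
  obj : A

namespace FactorCat
variable {k : Type t} [CommRing k] {A : Type u} [Category.{v} A] [Preadditive A] [Linear k A]
  (I : HomIdeal k A)

/-- Composition in the factor category, induced by composition of representatives. -/
def comp (X Y Z : A) : ((X ⟶ Y) ⧸ I.hom X Y) →ₗ[k] ((Y ⟶ Z) ⧸ I.hom Y Z) →ₗ[k]
    ((X ⟶ Z) ⧸ I.hom X Z) :=
  Submodule.liftQ _
    { toFun := fun f => Submodule.mapQ _ _ (Linear.leftComp k Z f) fun _ hg => I.comp_mem f hg
      map_add' := fun f f' => by
        ext g
        exact congrArg (I.hom X Z).mkQ (Preadditive.add_comp _ _ _ f f' g)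
      map_smul' := fun r f => by
        ext g
        exact congrArg (I.hom X Z).mkQ (Linear.smul_comp _ _ _ r f g) }
    (fun f hf => by
      rw [LinearMap.mem_ker]
      ext g
      exact (Submodule.Quotient.mk_eq_zero _).2 (I.mem_comp hf g))

instance : Category.{v} (FactorCat I) where
  Hom X Y := (X.obj ⟶ Y.obj) ⧸ I.hom X.obj Y.obj
  id X := Submodule.Quotient.mk (𝟙 X.obj)
  comp f g := comp I _ _ _ f g
  id_comp f := by
    obtain ⟨f, rfl⟩ := Submodule.Quotient.mk_surjective _ f
    exact congrArg _ (Category.id_comp f)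
  comp_id f := by
    obtain ⟨f, rfl⟩ := Submodule.Quotient.mk_surjective _ f
    exact congrArg _ (Category.comp_id f)
  assoc f g h := by
    obtain ⟨f, rfl⟩ := Submodule.Quotient.mk_surjective _ f
    obtain ⟨g, rfl⟩ := Submodule.Quotient.mk_surjective _ g
    obtain ⟨h, rfl⟩ := Submodule.Quotient.mk_surjective _ h
    exact congrArg _ (Category.assoc f g h)

instance : Preadditive (FactorCat I) where
  homGroup X Y := inferInstanceAs (AddCommGroup ((X.obj ⟶ Y.obj) ⧸ I.hom X.obj Y.obj))
  add_comp X Y Z f f' g := (comp I X.obj Y.obj Z.obj).map_add₂ f f' g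
  comp_add X Y Z f g g' := (comp I X.obj Y.obj Z.obj f).map_add g g'

instance : Linear k (FactorCat I) where
  homModule X Y := inferInstanceAs (Module k ((X.obj ⟶ Y.obj) ⧸ I.hom X.obj Y.obj))
  smul_comp X Y Z r f g := (comp I X.obj Y.obj Z.obj).map_smul₂ r f g
  comp_smul X Y Z f r g := (comp I X.obj Y.obj Z.obj f).map_smul r g

variable {I} in
/-- The class of a morphism in the factor category. -/
def mkHom {X Y : A} (f : X ⟶ Y) : (⟨X⟩ : FactorCat I) ⟶ ⟨Y⟩ := Submodule.Quotient.mk f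

lemma mkHom_surjective (X Y : A) :
    Function.Surjective (mkHom : (X ⟶ Y) → ((⟨X⟩ : FactorCat I) ⟶ ⟨Y⟩)) :=
  Submodule.Quotient.mk_surjective _

lemma mkHom_comp {X Y Z : A} (f : X ⟶ Y) (g : Y ⟶ Z) :
    (mkHom (f ≫ g) : (⟨X⟩ : FactorCat I) ⟶ ⟨Z⟩) = mkHom f ≫ mkHom g := rfl

end FactorCat
end Stable

section AR
variable (k : Type t) [CommRing k] (A : Type u) [Category.{v} A] [Abelian A] [Linear k A]
  [HasExt.{w} A]

/-- The ideal `𝒫` of projectively trivial morphisms: those `α : X ⟶ Y` with `Ext¹(α, -) = 0`. -/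
def projTrivial : HomIdeal k A where
  hom X Y :=
    { carrier := {α | ∀ (Z : A) (ξ : Ext.{w} Y Z 1), (Ext.mk₀ α).comp ξ (zero_add 1) = 0}
      add_mem' := fun hα hβ Z ξ => by rw [Ext.mk₀_add, Ext.add_comp, hα, hβ, add_zero]
      zero_mem' := fun Z ξ => by rw [Ext.mk₀_zero, Ext.zero_comp]
      smul_mem' := fun r α hα Z ξ => by rw [Ext.mk₀_smul, Ext.smul_comp, hα, smul_zero] }
  comp_mem f g hg Z ξ := by rw [← Ext.mk₀_comp_mk₀_assoc, hg, Ext.comp_zero]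
  mem_comp hf g Z ξ := by rw [← Ext.mk₀_comp_mk₀_assoc, hf]

/-- The ideal `ℐ` of injectively trivial morphisms: those `α : X ⟶ Y` with `Ext¹(-, α) = 0`. -/
def injTrivial : HomIdeal k A where
  hom X Y :=
    { carrier := {α | ∀ (Z : A) (ξ : Ext.{w} Z X 1), ξ.comp (Ext.mk₀ α) (add_zero 1) = 0}
      add_mem' := fun hα hβ Z ξ => by rw [Ext.mk₀_add, Ext.comp_add, hα, hβ, add_zero]
      zero_mem' := fun Z ξ => by rw [Ext.mk₀_zero, Ext.comp_zero]
      smul_mem' := fun r α hα Z ξ => by rw [Ext.mk₀_smul, Ext.comp_smul, hα, smul_zero] }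
  comp_mem f g hg Z ξ := by
    rw [← Ext.mk₀_comp_mk₀, ← Ext.comp_assoc_of_third_deg_zero, hg]
  mem_comp hf g Z ξ := by
    rw [← Ext.mk₀_comp_mk₀, ← Ext.comp_assoc_of_third_deg_zero, hf, Ext.zero_comp]

/-- The factor category of `A` by the projectively trivial morphisms. -/
abbrev Stable := FactorCat (projTrivial.{w} k A)
/-- The factor category of `A` by the injectively trivial morphisms. -/
abbrev Costable := FactorCat (injTrivial.{w} k A)

variable {A}
/-- `Hom(X, Y) ⧸ 𝒫(X, Y)`, as the morphisms of the stable category. -/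
abbrev StableHom (X Y : A) : Type v := (⟨X⟩ : Stable.{w} k A) ⟶ ⟨Y⟩

variable {k} in
/-- The left module structure over the opposite `Γ(X)ᵒᵖ` of `Γ(X) = End X` on
`Hom(X, Y) ⧸ 𝒫(X, Y)`, by composition: `g • f` is the class of `f ∘ g`. (Multiplication in `End X`
is composition of maps, `g * h = g ∘ h`.) -/
instance (X Y : A) : Module (End X)ᵐᵒᵖ (StableHom.{w} k X Y) where
  smul g f := (FactorCat.mkHom g.unop : StableHom.{w} k X X) ≫ f
  one_smul f := Category.id_comp f
  mul_smul g h f := Category.assoc (FactorCat.mkHom g.unop : StableHom.{w} k X X) (FactorCat.mkHom h.unop) f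
  smul_zero g := comp_zero
  smul_add g f f' := Preadditive.comp_add ..
  zero_smul f := zero_comp
  add_smul g h f := Preadditive.add_comp _ _ _ (FactorCat.mkHom g.unop : StableHom.{w} k X X) (FactorCat.mkHom h.unop) f

variable (A) in
/-- `A` is Hom-finite over `k`. -/
class HomFinite : Prop where
  finite (X Y : A) : Module.Finite k (X ⟶ Y)

variable (A) in
/-- Auslander-Reiten duality on `A`: a `k`-linear equivalence `τ` from the stable to the costable
category, with `k`-linear isomorphisms `Φ : D Ext¹(X, Y) ≅ Hom(Y, τ X) ⧸ ℐ(Y, τ X)` natural in `X`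
and `Y`. Mathlib's `≌` comes with a quasi-inverse `τ⁻¹` (`τ.inverse`) and with a natural isomorphism
`τ⁻¹ τ ≅ 𝟭` (`τ.unitInv`); both are arbitrary here. -/
structure ARDuality (E : Type t) [AddCommGroup E] [Module k E] where
  τ : Stable.{w} k A ≌ Costable.{w} k A
  additive : τ.functor.Additive
  linear : τ.functor.Linear k
  Φ (X Y : A) : MatlisDual k E (Ext.{w} X Y 1) ≃ₗ[k] ((⟨Y⟩ : Costable.{w} k A) ⟶ τ.functor.obj ⟨X⟩)
  naturality_left {X X' : A} (f : X ⟶ X') (Y : A) (φ : MatlisDual k E (Ext.{w} X Y 1)) :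
    Φ X' Y (φ ∘ₗ (Ext.bilinearCompOfLinear k X X' Y 0 1 1 (zero_add 1) (Ext.mk₀ f))) =
      Φ X Y φ ≫ τ.functor.map (FactorCat.mkHom f)
  naturality_right (X : A) {Y Y' : A} (g : Y' ⟶ Y) (φ : MatlisDual k E (Ext.{w} X Y 1)) :
    Φ X Y' (φ ∘ₗ (Ext.mk₀ g).postcompOfLinear k X (add_zero 1)) =
      FactorCat.mkHom g ≫ Φ X Y φ

end AR
section Classes
variable {A : Type u} [Category.{v} A]

/-- Right equivalence of morphisms to `Y`: each of the two factors through the other. -/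
def rightSetoid (Y : A) : Setoid (Over Y) where
  r α β := (∃ s : α.left ⟶ β.left, s ≫ β.hom = α.hom) ∧ ∃ s : β.left ⟶ α.left, s ≫ α.hom = β.hom
  iseqv :=
    { refl := fun α => ⟨⟨𝟙 _, Category.id_comp _⟩, ⟨𝟙 _, Category.id_comp _⟩⟩
      symm := fun h => ⟨h.2, h.1⟩
      trans := by
        rintro α β γ ⟨⟨s, hs⟩, ⟨s', hs'⟩⟩ ⟨⟨u, hu⟩, ⟨u', hu'⟩⟩
        exact ⟨⟨s ≫ u, by rw [Category.assoc, hu, hs]⟩, ⟨u' ≫ s', by rw [Category.assoc, hs', hu']⟩⟩ }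

/-- The right equivalence classes of morphisms to `Y`. -/
abbrev RightClass (Y : A) := Quotient (rightSetoid Y)

/-- The right equivalence class of `α`. -/
def RightClass.mk {X Y : A} (α : X ⟶ Y) : RightClass Y := Quotient.mk (rightSetoid Y) (Over.mk α)

/-- `α : X ⟶ Y` is right `C`-determined: a morphism `t : T ⟶ Y` factors through `α` as soon as all
the `t ∘ φ` with `φ : C ⟶ T` do. -/
def RightDetermined (C : A) {X Y : A} (α : X ⟶ Y) : Prop :=
  ∀ (T : A) (t : T ⟶ Y), (∀ φ : C ⟶ T, ∃ s : C ⟶ X, s ≫ α = φ ≫ t) → ∃ s : T ⟶ X, s ≫ α = t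

/-- The classes of epimorphisms. -/
def epiClasses (Y : A) : Set (RightClass Y) :=
  {c | ∃ (X : A) (α : X ⟶ Y), Epi α ∧ RightClass.mk α = c}

/-- The right `C`-determined classes. -/
def determinedClasses (C Y : A) : Set (RightClass Y) :=
  {c | ∃ (X : A) (α : X ⟶ Y), RightDetermined C α ∧ RightClass.mk α = c}

/-- The right `C`-determined right equivalence classes of epimorphisms to `Y`. -/
abbrev DetEpiClass (C Y : A) := ↥(epiClasses Y ∩ determinedClasses C Y)
end Classes

section F
variable {k : Type t} [CommRing k] {A : Type u} [Category.{v} A] [Abelian A] [Linear k A]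
  [HasExt.{w} A]

/-- The map `Hom(C, X) ⧸ 𝒫(C, X) → Hom(C, Y) ⧸ 𝒫(C, Y)` induced by `α : X ⟶ Y`, linear over
`Γ(C)ᵒᵖ`. -/
def stablePostcomp (k : Type t) [CommRing k] [Linear k A] (C : A) {X Y : A} (α : X ⟶ Y) :
    StableHom.{w} k C X →ₗ[(End C)ᵐᵒᵖ] StableHom.{w} k C Y where
  toFun f := f ≫ FactorCat.mkHom α
  map_add' f f' := Preadditive.add_comp ..
  map_smul' g f := Category.assoc _ _ _

lemma range_stablePostcomp_le (C : A) {X X' Y : A} {α : X ⟶ Y} {α' : X' ⟶ Y} (s : X ⟶ X')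
    (hs : s ≫ α' = α) :
    LinearMap.range (stablePostcomp.{w} k C α) ≤ LinearMap.range (stablePostcomp.{w} k C α') := by
  rintro _ ⟨f, rfl⟩
  subst hs
  exact ⟨f ≫ (FactorCat.mkHom s : StableHom.{w} k X X'),
    Category.assoc f (FactorCat.mkHom s : StableHom.{w} k X X') (FactorCat.mkHom α')⟩

variable (k) in
/-- The map `η` of the restricted Auslander bijection, which sends the class of `α : X ⟶ Y` to the
image of `Hom(C, X) ⧸ 𝒫(C, X) → Hom(C, Y) ⧸ 𝒫(C, Y)`. (If `A` is Hom-finite over an artinian ring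
`k`, all submodules are finitely generated.) -/
def eta (C Y : A) (c : DetEpiClass C Y) : Submodule (End C)ᵐᵒᵖ (StableHom.{w} k C Y) :=
  Quotient.lift (s := rightSetoid Y) (fun α => LinearMap.range (stablePostcomp.{w} k C α.hom))
    (fun _ _ h => le_antisymm (range_stablePostcomp_le C _ h.1.choose_spec)
      (range_stablePostcomp_le C _ h.2.choose_spec)) c.1

variable {E : Type t} [AddCommGroup E] [Module k E]

namespace ARDuality
variable (T : ARDuality.{w} k A E)

/-- The object `τ⁻¹ K`, as an object of `A`. -/
def tauInv (K : A) : A := (T.τ.inverse.obj ⟨K⟩).obj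

/-- The isomorphism `Ψ`: apply `Φ`, then the functor `τ⁻¹`, then the natural isomorphism
`τ⁻¹ τ X ≅ X`. -/
noncomputable def PsiAux (X K : A) :
    MatlisDual k E (Ext.{w} X K 1) ≃ₗ[k] (T.τ.inverse.obj ⟨K⟩ ⟶ (⟨X⟩ : Stable.{w} k A)) where
  toFun φ := T.τ.inverse.map (T.Φ X K φ) ≫ T.τ.unitInv.app ⟨X⟩
  map_add' φ ψ := by
    have := T.additive
    rw [map_add, Functor.map_add, Preadditive.add_comp]
  map_smul' r φ := by
    have := T.additive
    have := T.linear
    rw [map_smul, Functor.map_smul, Linear.smul_comp, RingHom.id_apply]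
  invFun f := (T.Φ X K).symm (T.τ.inverse.preimage (f ≫ T.τ.unit.app ⟨X⟩))
  left_inv φ := by simp
  right_inv f := by simp

/-- `Ψ : D Ext¹(X, K) ≅ Hom(τ⁻¹ K, X) ⧸ 𝒫(τ⁻¹ K, X)`. -/
noncomputable def Psi (X K : A) :
    MatlisDual k E (Ext.{w} X K 1) ≃ₗ[k] StableHom.{w} k (T.tauInv K) X :=
  T.PsiAux X K

lemma Psi_naturality {X X' : A} (f : X ⟶ X') (K : A) (φ : MatlisDual k E (Ext.{w} X K 1)) :
    T.Psi X' K (φ ∘ₗ (Ext.bilinearCompOfLinear k X X' K 0 1 1 (zero_add 1) (Ext.mk₀ f))) =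
      T.Psi X K φ ≫ FactorCat.mkHom f := by
  change T.τ.inverse.map (T.Φ X' K _) ≫ T.τ.unitInv.app ⟨X'⟩ =
    (T.τ.inverse.map (T.Φ X K φ) ≫ T.τ.unitInv.app ⟨X⟩) ≫ _
  rw [T.naturality_left, Functor.map_comp, Category.assoc, Category.assoc]
  congr 1
  exact T.τ.unitInv.naturality (FactorCat.mkHom f)

/-- An epimorphism to `Y` with kernel `K` is right `τ⁻¹ K`-determined. -/
lemma rightDetermined (hE : IsMinimalInjectiveCogenerator k E) {K X Y : A} (i : K ⟶ X) (α : X ⟶ Y)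
    (h : i ≫ α = 0) (hS : (ShortComplex.mk i α h).ShortExact) :
    RightDetermined (T.tauInv K) α := by
  intro Z t ht
  suffices hz : (Ext.mk₀ t).comp hS.extClass.{w} (zero_add 1) = 0 by
    obtain ⟨s, hs⟩ := Ext.covariant_sequence_exact₃ Z hS (Ext.mk₀ t) (zero_add 1) hz
    obtain ⟨s, rfl⟩ := (Ext.mk₀_bijective _ _).2 s
    exact ⟨s, (Ext.mk₀_bijective _ _).1 (by rw [← Ext.mk₀_comp_mk₀]; exact hs)⟩
  by_contra hne
  obtain ⟨ψ, hψ⟩ := hE.exists_ne_zero hne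
  obtain ⟨φ, hφ⟩ := FactorCat.mkHom_surjective _ _ _ (T.Psi Z K ψ)
  obtain ⟨χ, hχ⟩ := (T.Psi (T.tauInv K) K).surjective (𝟙 _)
  have h1 := T.Psi_naturality φ K χ
  rw [hχ, Category.id_comp, hφ] at h1
  have h2 := (T.Psi Z K).injective h1
  obtain ⟨s, hs⟩ := ht φ
  apply hψ
  rw [← h2]
  change χ ((Ext.mk₀ φ).comp ((Ext.mk₀ t).comp hS.extClass (zero_add 1)) (zero_add 1)) = 0
  rw [Ext.mk₀_comp_mk₀_assoc, ← hs, ← Ext.mk₀_comp_mk₀_assoc,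
    ShortComplex.ShortExact.comp_extClass hS, Ext.comp_zero, map_zero]

section
variable [IsArtinianRing k] [HomFinite k A]

lemma finite_ext (T : ARDuality.{w} k A E) (hE : IsMinimalInjectiveCogenerator k E) (X Y : A) :
    Module.Finite k (Ext.{w} X Y 1) := by
  have : Module.Finite k ((⟨Y⟩ : Costable.{w} k A) ⟶ T.τ.functor.obj ⟨X⟩) := by
    have := HomFinite.finite (k := k) Y (T.τ.functor.obj ⟨X⟩).obj
    exact Module.Finite.quotient k ((injTrivial.{w} k A).hom Y (T.τ.functor.obj ⟨X⟩).obj)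
  have := Module.Finite.equiv (T.Φ X Y).symm
  exact hE.finite_of_dual _

/-- The map `D Ψ : D (Hom(τ⁻¹ K, Y) ⧸ 𝒫(τ⁻¹ K, Y)) → D D Ext¹(Y, K) = Ext¹(Y, K)`, where the last
identification is the inverse of the evaluation map. -/
noncomputable def dualPsi (hE : IsMinimalInjectiveCogenerator k E) (Y K : A) :
    MatlisDual k E (StableHom.{w} k (T.tauInv K) Y) →ₗ[k] Ext.{w} Y K 1 :=
  have := T.finite_ext hE Y K
  (LinearEquiv.ofBijective (evalMap k E (Ext.{w} Y K 1)) (hE.evalMap_bijective _)).symm.toLinearMap ∘ₗ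
    LinearMap.lcomp k E (T.Psi Y K).toLinearMap

lemma apply_dualPsi (hE : IsMinimalInjectiveCogenerator k E) (Y K : A)
    (θ : MatlisDual k E (StableHom.{w} k (T.tauInv K) Y)) (φ : MatlisDual k E (Ext.{w} Y K 1)) :
    φ (T.dualPsi hE Y K θ) = θ (T.Psi Y K φ) := by
  have := T.finite_ext hE Y K
  have := LinearEquiv.apply_symm_apply (LinearEquiv.ofBijective (evalMap k E (Ext.{w} Y K 1))
    (hE.evalMap_bijective _)) (θ ∘ₗ (T.Psi Y K).toLinearMap)
  exact DFunLike.congr_fun this φ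

end

/-- The map `κ`, which sends the class of an exact sequence `0 → K → X → Y → 0` to the class of the
epimorphism `X ⟶ Y`. By `kappa_extClass` it does not depend on the chosen sequence. -/
noncomputable def kappa (hE : IsMinimalInjectiveCogenerator k E) (Y K : A) (x : Ext.{w} Y K 1) :
    DetEpiClass (T.tauInv K) Y :=
  have h := exists_shortExact_extClass x
  ⟨RightClass.mk h.choose_spec.choose_spec.choose,
    have hS := h.choose_spec.choose_spec.choose_spec.choose_spec.choose
    ⟨⟨_, _, hS.epi_g, rfl⟩, ⟨_, _, T.rightDetermined hE _ _ _ hS, rfl⟩⟩⟩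

lemma kappa_extClass (hE : IsMinimalInjectiveCogenerator k E) {Y K X : A} (i : K ⟶ X) (α : X ⟶ Y)
    (h : i ≫ α = 0) (hS : (ShortComplex.mk i α h).ShortExact) :
    (T.kappa hE Y K hS.extClass.{w}).1 = RightClass.mk α := by
  have fac : ∀ {X X' : A} {i : K ⟶ X} {α : X ⟶ Y} {h : i ≫ α = 0}
      (hS : (ShortComplex.mk i α h).ShortExact) {i' : K ⟶ X'} {α' : X' ⟶ Y} {h' : i' ≫ α' = 0}
      (hS' : (ShortComplex.mk i' α' h').ShortExact) (_ : hS.extClass.{w} = hS'.extClass),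
      ∃ s : X ⟶ X', s ≫ α' = α := fun {X X' i α h} hS {i' α' h'} hS' he => by
    have hz := hS.comp_extClass
    rw [he] at hz
    obtain ⟨s, hs⟩ := Ext.covariant_sequence_exact₃ _ hS' _ (zero_add 1) hz
    obtain ⟨s, rfl⟩ := (Ext.mk₀_bijective _ _).2 s
    exact ⟨s, (Ext.mk₀_bijective _ _).1 (by rw [← Ext.mk₀_comp_mk₀]; exact hs)⟩
  have he := (exists_shortExact_extClass hS.extClass.{w}).choose_spec.choose_spec.choose_spec.choose_spec.choose_spec
  exact Quotient.sound (s := rightSetoid Y) ⟨fac _ hS he, fac hS _ he.symm⟩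

/-- The composite `F = η ∘ κ ∘ D Ψ`, with `C = τ⁻¹ K`. -/
noncomputable def ringelF [IsArtinianRing k] [HomFinite k A] (hE : IsMinimalInjectiveCogenerator k E)
    (Y K : A) (θ : MatlisDual k E (StableHom.{w} k (T.tauInv K) Y)) :
    Submodule (End (T.tauInv K))ᵐᵒᵖ (StableHom.{w} k (T.tauInv K) Y) :=
  eta k (T.tauInv K) Y (T.kappa hE Y K (T.dualPsi hE Y K θ))

end ARDuality
end F

end AuslanderBij

open AuslanderBij

namespace AuslanderBij

/-! Write `x` in Ext¹(Y, K) for the image of `θ` under `dualPsi`. It is characterised by φ(x) =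
θ(Ψ(φ)) for all φ in D Ext¹(Y, K) (`apply_dualPsi`). Represent `x` by an extension with epimorphism
`α : X ⟶ Y`. By the long exact sequence, `f : C ⟶ Y` lifts through `α` exactly when the pullback f*x
in Ext¹(C, K) vanishes. Projectively trivial maps pull every class back to zero, so this condition
depends only on the stable class of `f`, and F(θ) consists of the stable `f` with f*x = 0.

Since `E` is a cogenerator, f*x = 0 means χ(f*x) = 0 for every χ in D Ext¹(C, K). Naturality of Ψ in
the first variable gives χ(f*x) = θ(Ψ(χ ∘ f*)) = θ(f ∘ Ψ(χ)). As C = τ⁻¹K, the isomorphism Ψ at `C`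
identifies D Ext¹(C, K) with the stable endomorphisms of `C`, so Ψ(χ) runs through the classes of
all g in Γ(C). This is the formula for F(θ); the maximality is then formal. The two halves are
`mkHom_mem_eta_kappa_iff` and `mem_ringelF_iff`. -/

/-- A stable morphism to `Y` lies in the image of `Hom(C, α)` if and only if the class of the
extension with epimorphism `α` pulls back to zero along a representative. -/
lemma mkHom_mem_range_stablePostcomp_iff {k : Type t} [CommRing k] {A : Type u} [Category.{v} A]
    [Abelian A] [Linear k A] [HasExt.{w} A] {C K X Y : A} {i : K ⟶ X} {α : X ⟶ Y} {h : i ≫ α = 0}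
    (hS : (ShortComplex.mk i α h).ShortExact) (f : C ⟶ Y) :
    (FactorCat.mkHom f : StableHom.{w} k C Y) ∈ LinearMap.range (stablePostcomp.{w} k C α) ↔
      (Ext.mk₀ f).comp hS.extClass.{w} (zero_add 1) = 0 := by
  constructor
  · rintro ⟨g, hg⟩
    obtain ⟨g, rfl⟩ := FactorCat.mkHom_surjective _ _ _ g
    -- Equality of stable classes makes `g ≫ α` and `f` agree only up to a projectively trivial map;
    -- that difference pulls the class of the extension back to zero, by definition of 𝒫 applied
    -- with target `K`.
    have hmem : g ≫ α - f ∈ (projTrivial.{w} k A).hom C Y :=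
      (Submodule.Quotient.eq ((projTrivial.{w} k A).hom C Y)).1 hg
    have hz : (Ext.mk₀ (g ≫ α - f)).comp hS.extClass.{w} (zero_add 1) = 0 := hmem K hS.extClass
    have hα : (Ext.mk₀ α).comp hS.extClass.{w} (zero_add 1) = 0 := hS.comp_extClass
    have hf : f = g ≫ α - (g ≫ α - f) := (sub_sub_cancel _ _).symm
    rw [hf, sub_eq_add_neg, Ext.mk₀_add, Ext.mk₀_neg, Ext.add_comp, Ext.neg_comp, hz,
      ← Ext.mk₀_comp_mk₀_assoc, hα, Ext.comp_zero, neg_zero, add_zero]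
  · intro hz
    -- Exactness at Hom(C, Y) gives a lift of `f` itself through `α`, so no correction by 𝒫 is
    -- needed in this direction.
    obtain ⟨s, hs⟩ := Ext.covariant_sequence_exact₃ C hS (Ext.mk₀ f) (zero_add 1) hz
    obtain ⟨s, rfl⟩ := (Ext.mk₀_bijective _ _).2 s
    have hs' : s ≫ α = f := (Ext.mk₀_bijective _ _).1 (by rw [← Ext.mk₀_comp_mk₀]; exact hs)
    exact ⟨FactorCat.mkHom s, congrArg FactorCat.mkHom hs'⟩

namespace ARDuality
variable {k : Type t} [CommRing k] {E : Type t} [AddCommGroup E] [Module k E]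
  {A : Type u} [Category.{v} A] [Abelian A] [Linear k A] [HasExt.{w} A] (T : ARDuality.{w} k A E)

/-- `η` of the class of an extension consists of the stable morphisms along which it pulls back to
zero. -/
lemma mkHom_mem_eta_kappa_iff (hE : IsMinimalInjectiveCogenerator k E) {Y K : A}
    (x : Ext.{w} Y K 1) (f : T.tauInv K ⟶ Y) :
    (FactorCat.mkHom f : StableHom.{w} k (T.tauInv K) Y) ∈
        eta k (T.tauInv K) Y (T.kappa hE Y K x) ↔
      (Ext.mk₀ f).comp x (zero_add 1) = 0 := by
  obtain ⟨X, i, α, h, hS, rfl⟩ := exists_shortExact_extClass x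
  -- `kappa` uses a chosen sequence with class `x`, possibly different from the one just obtained;
  -- both have the same right equivalence class, and `eta` depends on nothing else.
  have : eta.{w} k (T.tauInv K) Y (T.kappa hE Y K hS.extClass) =
      LinearMap.range (stablePostcomp.{w} k (T.tauInv K) α) := by
    unfold eta
    rw [T.kappa_extClass hE i α h hS]
    rfl
  rw [this, mkHom_mem_range_stablePostcomp_iff hS]

/-- The cogenerator `E` tests the vanishing of a pullback in Ext¹(τ⁻¹K, K) by functionals, and Ψ
turns these functionals into stable endomorphisms of τ⁻¹K. -/
lemma mem_ringelF_iff [IsArtinianRing k] [HomFinite k A] (hE : IsMinimalInjectiveCogenerator k E)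
    {Y K : A} (θ : StableHom.{w} k (T.tauInv K) Y →ₗ[k] E) (f : StableHom.{w} k (T.tauInv K) Y) :
    f ∈ T.ringelF hE Y K θ ↔ ∀ g : End (T.tauInv K),
      θ ((FactorCat.mkHom g : StableHom.{w} k (T.tauInv K) (T.tauInv K)) ≫ f) = 0 := by
  obtain ⟨f, rfl⟩ := FactorCat.mkHom_surjective _ _ _ f
  -- The functional "pull back along `f`, then apply `χ`" on Ext¹(Y, K) has two descriptions: Ψ
  -- sends it to Ψ(χ) followed by `f`, and evaluating it at `dualPsi` of `θ` is applying `θ` to its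
  -- image under Ψ.
  have key (χ : MatlisDual k E (Ext.{w} (T.tauInv K) K 1)) :
      χ ((Ext.mk₀ f).comp (T.dualPsi hE Y K θ) (zero_add 1)) =
        θ (T.Psi (T.tauInv K) K χ ≫ FactorCat.mkHom f) := by
    rw [← T.Psi_naturality, ← T.apply_dualPsi hE]
    rfl
  refine (T.mkHom_mem_eta_kappa_iff hE _ f).trans ⟨fun hz g => ?_, fun hf => ?_⟩
  -- Surjectivity of Ψ realises the class of each endomorphism `g` by a functional `χ`.
  · obtain ⟨χ, hχ⟩ := (T.Psi (T.tauInv K) K).surjective (FactorCat.mkHom g)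
    rw [← hχ, ← key, hz, map_zero]
  · by_contra hne
    -- A nonzero pullback would be detected by some `χ`; any representative `g` of the stable
    -- endomorphism Ψ(χ) then contradicts `hf`.
    obtain ⟨χ, hχ⟩ := hE.exists_ne_zero hne
    obtain ⟨g, hg⟩ := FactorCat.mkHom_surjective _ _ _ (T.Psi (T.tauInv K) K χ)
    exact hχ (by rw [key, ← hg, hf g])

end ARDuality

end AuslanderBij

theorem corollary5p4 {k : Type t} [CommRing k] [IsArtinianRing k]
    {E : Type t} [AddCommGroup E] [Module k E] (hE : IsMinimalInjectiveCogenerator k E)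
    {A : Type u} [Category.{v} A] [Abelian A] [Linear k A] [HasExt.{w} A] [HomFinite k A]
    (T : ARDuality.{w} k A E) (K Y : A)
    (θ : StableHom.{w} k (T.tauInv K) Y →ₗ[k] E) :
    (T.ringelF hE Y K θ : Set (StableHom.{w} k (T.tauInv K) Y)) =
        {f | ∀ g : End (T.tauInv K),
          θ ((FactorCat.mkHom g : StableHom.{w} k (T.tauInv K) (T.tauInv K)) ≫ f) = 0} ∧
      IsGreatest
        {N : Submodule (End (T.tauInv K))ᵐᵒᵖ (StableHom.{w} k (T.tauInv K) Y) |
          (N : Set (StableHom.{w} k (T.tauInv K) Y)) ⊆ LinearMap.ker θ}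
        (T.ringelF hE Y K θ) := by
  refine ⟨Set.ext fun f => T.mem_ringelF_iff hE θ f, fun f hf => ?_, fun N hN f hf => ?_⟩
  -- Taking `g` to be the identity shows that F(θ) lies in the kernel of `θ`.
  · have h := (T.mem_ringelF_iff hE θ f).1 hf (𝟙 _)
    exact LinearMap.mem_ker.2 ((congrArg θ (Category.id_comp f)).symm.trans h)
  -- A submodule `N` inside the kernel contains `f ∘ g` with `f`, because this is by definition the
  -- action of `op g` on `f`; hence `θ` kills every `f ∘ g`.
  · exact (T.mem_ringelF_iff hE θ f).2 fun g =>
      LinearMap.mem_ker.1 (hN (N.smul_mem (MulOpposite.op g) hf))
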